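/- For positive integers $k,m,n$ let $$f_k(m,n)=\Big|\Big\{(a_1,\dots,a_k)\in\mathbb{Z}_{>0}^k : a_1\le\dots\le a_k,\ \frac mn=\sum_{i=1}^k\frac1{a_i}\Big\}\Big|.$$ Let $(u_n)_{n\ge 0}$ be defined by $u_0=1$ and $u_{n+1}=u_n(u_n+1)$; the limit $c_0=\lim_{n\to\infty}u_n^{2^{-n}}$ exists. For every $\varepsilon>0$ the following hold, all the counts being finite. 1. There is a constant $C_\varepsilon>0$, depending only on $\varepsilon$, such that for all $k\ge 1$ $$f_k(1,1)\le C_\varepsilon\, k^{\frac{2}{15}\cdot 2^{k-1}+\varepsilon}.$$ 2. There is $k(\varepsilon)$ such that for all $k\ge k(\varepsilon)$ $$f_k(1,1)<c_0^{(\frac25+\varepsilon)2^{k-1}}.$$ 3. There is $k(\varepsilon)$ such that for all $k\ge k(\varepsilon)$ the number of tuples $(a_1,\dots,a_k)$ of positive integers (in any order) satisfying $$1=\sum_{i=1}^k\frac1{a_i}+\frac1{\prod_{i=1}^k a_i}$$ is at most $c_0^{(\frac25+\varepsilon)2^k}$. -/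

import Mathlib

/-- The nondecreasing `k`-tuples of positive integers whose reciprocals sum to `m / n`. -/
def unitFractionReps (k m n : ℕ) : Set (Fin k → ℕ) :=
  {a | (∀ i, 0 < a i) ∧ Monotone a ∧ (m : ℚ) / (n : ℚ) = ∑ i, 1 / (a i : ℚ)}

/-- `f_k(m, n)`: the number of representations of `m / n` as a sum of `k` unit fractions,
the denominators being listed in nondecreasing order. -/
noncomputable def numUnitFractionReps (k m n : ℕ) : ℕ :=
  (unitFractionReps k m n).ncard

/-- The sequence `u 0 = 1`, `u (n + 1) = u n * (u n + 1)`. -/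
def sylvesterU : ℕ → ℕ
  | 0 => 1
  | n + 1 => sylvesterU n * (sylvesterU n + 1)

/-- All `k`-tuples of positive integers (in any order) with `1 = ∑ 1 / a i + 1 / ∏ a i`. -/
def productSolutions (k : ℕ) : Set (Fin k → ℕ) :=
  {a | (∀ i, 0 < a i) ∧ (1 : ℚ) = (∑ i, 1 / (a i : ℚ)) + 1 / (∏ i, (a i : ℚ))}

/-! ### The divisor bound -/

theorem exists_card_divisors_le_rpow {δ : ℝ} (hδ : 0 < δ) :
    ∃ C : ℝ, 1 ≤ C ∧ ∀ n : ℕ, n ≠ 0 → (n.divisors.card : ℝ) ≤ C * (n : ℝ) ^ δ := by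
  obtain ⟨B, hB⟩ := exists_nat_ge ((2 : ℝ) ^ (1 / δ))
  set A : ℝ := 1 + 1 / (δ * Real.log 2) with hA
  have hlog : 0 < Real.log 2 := Real.log_pos (by norm_num)
  have hA1 : 1 ≤ A := by rw [hA]; linarith [show 0 < 1 / (δ * Real.log 2) by positivity]
  refine ⟨A ^ B, one_le_pow₀ hA1, fun n hn => ?_⟩
  -- Primes `p ≥ B` have `p ^ δ ≥ 2`, so `e + 1 ≤ 2 ^ e` costs no constant; each of the fewer than
  -- or exactly `B` smaller ones costs at most `A`.
  have key : ∀ p ∈ n.primeFactors, ((n.factorization p + 1 : ℕ) : ℝ) ≤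
      (if p < B then A else 1) * ((p : ℝ) ^ (n.factorization p)) ^ δ := by
    intro p hp
    have hp2 : (2 : ℝ) ≤ p := by exact_mod_cast (Nat.prime_of_mem_primeFactors hp).two_le
    set e := n.factorization p
    have hcomm : ((p : ℝ) ^ e) ^ δ = ((p : ℝ) ^ δ) ^ e := by
      rw [← Real.rpow_natCast, ← Real.rpow_natCast, ← Real.rpow_mul (by positivity),
        ← Real.rpow_mul (by positivity), mul_comm]
    split_ifs with hpB
    · have h1 : 1 + e * (δ * Real.log 2) ≤ ((p : ℝ) ^ e) ^ δ := by
        have h2 : ((2 : ℝ) ^ e) ^ δ ≤ ((p : ℝ) ^ e) ^ δ := by gcongr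
        refine le_trans ?_ h2
        have h3 : ((2 : ℝ) ^ e) ^ δ = Real.exp (e * (δ * Real.log 2)) := by
          rw [Real.rpow_def_of_pos (by positivity), Real.log_pow]
          ring_nf
        rw [h3]
        linarith [Real.add_one_le_exp (e * (δ * Real.log 2))]
      have hc : 0 < δ * Real.log 2 := by positivity
      have h4 : (e + 1 : ℝ) ≤ A * (1 + e * (δ * Real.log 2)) := by
        rw [hA]
        have : 1 / (δ * Real.log 2) * (e * (δ * Real.log 2)) = e := by field_simp
        have h5 : 0 ≤ 1 / (δ * Real.log 2) := by positivity
        have h6 : 0 ≤ e * (δ * Real.log 2) := by positivity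
        nlinarith
      push_cast
      exact h4.trans (by gcongr)
    · have hpB' : (B : ℝ) ≤ p := by exact_mod_cast not_lt.mp hpB
      have h1 : (2 : ℝ) ≤ (p : ℝ) ^ δ := by
        calc (2 : ℝ) = ((2 : ℝ) ^ (1 / δ)) ^ δ := by
              rw [← Real.rpow_mul (by norm_num)]; field_simp; simp
          _ ≤ (p : ℝ) ^ δ := by gcongr; exact hB.trans hpB'
      rw [one_mul, hcomm]
      calc ((e + 1 : ℕ) : ℝ) ≤ ((2 ^ e : ℕ) : ℝ) := by exact_mod_cast Nat.lt_two_pow_self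
        _ = (2 : ℝ) ^ e := by push_cast; rfl
        _ ≤ _ := by gcongr
  rw [Nat.card_divisors hn]
  push_cast
  calc ∏ p ∈ n.primeFactors, ((n.factorization p : ℝ) + 1)
      ≤ ∏ p ∈ n.primeFactors,
        (if p < B then A else 1) * ((p : ℝ) ^ (n.factorization p)) ^ δ :=
        Finset.prod_le_prod (fun _ _ => by positivity)
          (fun p hp => by simpa using key p hp)
    _ = (∏ p ∈ n.primeFactors, if p < B then A else 1) * (n : ℝ) ^ δ := by
        rw [Finset.prod_mul_distrib, Real.finsetProd_rpow _ _ (fun _ _ => by positivity)]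
        congr 2
        conv_rhs => rw [← Nat.prod_factorization_pow_eq_self hn]
        rw [Finsupp.prod, Nat.support_factorization]
        push_cast
        rfl
    _ ≤ A ^ B * (n : ℝ) ^ δ := by
        gcongr
        rw [← Finset.prod_filter, Finset.prod_const]
        refine pow_le_pow_right₀ hA1 ?_
        calc _ ≤ (Finset.range B).card := Finset.card_le_card fun p hp => by
              simpa using (Finset.mem_filter.mp hp).2
          _ = B := Finset.card_range B

/-! ### The sequence `sylvesterU` -/

theorem sylvesterU_pos (n : ℕ) : 0 < sylvesterU n := by
  induction n with
  | zero => simp [sylvesterU]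
  | succ n ih => simp only [sylvesterU]; positivity

theorem prod_sylvesterU_add_one (n : ℕ) :
    ∏ i ∈ Finset.range n, (sylvesterU i + 1) = sylvesterU n := by
  induction n with
  | zero => simp [sylvesterU]
  | succ n ih => rw [Finset.prod_range_succ, ih, sylvesterU]

theorem prod_sylvesterU_le (n : ℕ) :
    ∏ i ∈ Finset.range n, sylvesterU i ≤ sylvesterU n := by
  rw [← prod_sylvesterU_add_one n]
  exact Finset.prod_le_prod' fun i _ => Nat.le_succ _

theorem sum_one_div_sylvesterU_add_one (n : ℕ) :
    ∑ i ∈ Finset.range n, 1 / ((sylvesterU i : ℚ) + 1) = 1 - 1 / sylvesterU n := by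
  induction n with
  | zero => simp [sylvesterU]
  | succ n ih =>
    have := sylvesterU_pos n
    rw [Finset.sum_range_succ, ih, sylvesterU]
    push_cast
    field_simp
    ring

/-! ### Partial remainders of Egyptian fractions -/

/-- The numerator of `1 - ∑ i < n, 1 / a i` over the denominator `∏ i < n, a i`. -/
def remainderNum (a : ℕ → ℕ) : ℕ → ℤ
  | 0 => 1
  | n + 1 => remainderNum a n * a n - ∏ i ∈ Finset.range n, (a i : ℤ)

theorem remainderNum_congr {a b : ℕ → ℕ} {n : ℕ} (h : ∀ i < n, a i = b i) :
    remainderNum a n = remainderNum b n := by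
  induction n with
  | zero => rfl
  | succ n ih =>
    rw [remainderNum, remainderNum, ih fun i hi => h i (by omega), h n (by omega)]
    congr 1
    exact Finset.prod_congr rfl fun i hi => by rw [h i (by simp at hi; omega)]

theorem remainderNum_eq {a : ℕ → ℕ} {n : ℕ} (h : ∀ i < n, 0 < a i) :
    (remainderNum a n : ℚ) =
      (∏ i ∈ Finset.range n, (a i : ℚ)) * (1 - ∑ i ∈ Finset.range n, 1 / (a i : ℚ)) := by
  induction n with
  | zero => simp [remainderNum]
  | succ n ih =>
    have := h n (by omega)
    rw [remainderNum, Finset.prod_range_succ, Finset.sum_range_succ]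
    push_cast
    rw [ih fun i hi => h i (by omega)]
    field_simp
    ring

/-- Abel summation: replacing `a l` by the larger `a (l + 1)` only lowers its product with a
nonpositive partial sum. The full sum, of length `n`, may have either sign. -/
theorem le_sum_mul_of_partial_sums_nonpos {a d : ℕ → ℚ} {n : ℕ}
    (hmono : ∀ i, i + 1 < n → a i ≤ a (i + 1))
    (hneg : ∀ l < n, ∑ i ∈ Finset.range l, d i ≤ 0) :
    ∀ l < n, a l * ∑ i ∈ Finset.range (l + 1), d i ≤
      ∑ i ∈ Finset.range (l + 1), a i * d i := by
  intro l
  induction l with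
  | zero => intro _; simp
  | succ l ih =>
    intro hl
    rw [Finset.sum_range_succ, Finset.sum_range_succ (n := l + 1)]
    have h1 := ih (by omega)
    have h2 := hneg (l + 1) hl
    have h3 := hmono l hl
    nlinarith

/-- Among sums of `n` unit fractions smaller than `1`, the greedy one is the largest. -/
theorem one_div_sylvesterU_le {a : ℕ → ℕ} {n : ℕ} (hpos : ∀ i < n, 0 < a i)
    (hmono : ∀ i, i + 1 < n → a i ≤ a (i + 1))
    (hlt : ∑ i ∈ Finset.range n, 1 / (a i : ℚ) < 1) :
    1 / (sylvesterU n : ℚ) ≤ 1 - ∑ i ∈ Finset.range n, 1 / (a i : ℚ) := by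
  induction n using Nat.strong_induction_on with
  | _ n ih =>
  have hP : 0 < ∏ i ∈ Finset.range n, (a i : ℚ) :=
    Finset.prod_pos fun i hi => by exact_mod_cast hpos i (by simpa using hi)
  have hprefix : ∀ l < n, ∑ i ∈ Finset.range l, 1 / (a i : ℚ) ≤ 1 - 1 / (sylvesterU l : ℚ) := by
    intro l hl
    have := ih l hl (fun i hi => hpos i (by omega)) (fun i hi => hmono i (by omega))
      (lt_of_le_of_lt (Finset.sum_le_sum_of_subset_of_nonneg
        (Finset.range_subset_range.mpr hl.le) fun i _ _ => by positivity) hlt)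
    linarith
  by_contra! hcon
  have hu : 0 < (sylvesterU n : ℚ) := by exact_mod_cast sylvesterU_pos n
  -- The remainder is a positive fraction with denominator the product, so a remainder below `1 /
  -- u_n` needs a product above `u_n`. The rest of the proof bounds the product by `u_n`.
  have hPgt : (sylvesterU n : ℚ) < ∏ i ∈ Finset.range n, (a i : ℚ) := by
    have h1 := remainderNum_eq hpos
    have h2 : (0 : ℚ) < remainderNum a n := by rw [h1]; exact mul_pos hP (by linarith)
    have h3 : (1 : ℚ) ≤ remainderNum a n := by exact_mod_cast h2
    rw [lt_div_iff₀ hu] at hcon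
    rw [h1] at h3
    by_contra! h4
    have h5 : 0 < 1 - ∑ i ∈ Finset.range n, 1 / (a i : ℚ) := by linarith
    nlinarith
  rcases n with _ | m
  · simp [sylvesterU] at hPgt
  -- Partial sums of `d` are nonpositive before the end by induction, but the full sum is positive
  -- by assumption. Abel summation with weights `a i` then bounds the mean of `a i / (u_i + 1)` by
  -- 1, and `1 + x ≤ exp x` does the same for the product.
  set d : ℕ → ℚ := fun i => 1 / (a i : ℚ) - 1 / ((sylvesterU i : ℚ) + 1) with hd
  have hD : ∀ l, ∑ i ∈ Finset.range l, d i =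
      ∑ i ∈ Finset.range l, 1 / (a i : ℚ) - (1 - 1 / (sylvesterU l : ℚ)) := fun l => by
    rw [hd, Finset.sum_sub_distrib, sum_one_div_sylvesterU_add_one]
  have hab := le_sum_mul_of_partial_sums_nonpos (a := fun i => (a i : ℚ)) (d := d) (n := m + 1)
    (fun i hi => by exact_mod_cast hmono i hi)
    (fun l hl => by rw [hD]; linarith [hprefix l hl]) m (by omega)
  have hnn : 0 ≤ ∑ i ∈ Finset.range (m + 1), (a i : ℚ) * d i := by
    refine le_trans (mul_nonneg (by positivity) ?_) hab
    rw [hD]; linarith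
  have hsum : ∑ i ∈ Finset.range (m + 1), ((a i : ℚ) / ((sylvesterU i : ℚ) + 1) - 1) ≤ 0 := by
    have : ∑ i ∈ Finset.range (m + 1), ((a i : ℚ) / ((sylvesterU i : ℚ) + 1) - 1) =
        -∑ i ∈ Finset.range (m + 1), (a i : ℚ) * d i := by
      rw [← Finset.sum_neg_distrib]
      refine Finset.sum_congr rfl fun i hi => ?_
      have : (0 : ℚ) < a i := by exact_mod_cast hpos i (by simpa using hi)
      rw [hd]
      field_simp
      ring
    linarith
  have hprod : ∏ i ∈ Finset.range (m + 1), ((a i : ℝ) / ((sylvesterU i : ℝ) + 1)) ≤ 1 := by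
    calc _ ≤ ∏ i ∈ Finset.range (m + 1), Real.exp ((a i : ℝ) / ((sylvesterU i : ℝ) + 1) - 1) :=
          Finset.prod_le_prod (fun _ _ => by positivity) fun i _ => by
            linarith [Real.add_one_le_exp ((a i : ℝ) / ((sylvesterU i : ℝ) + 1) - 1)]
      _ = Real.exp (∑ i ∈ Finset.range (m + 1), ((a i : ℝ) / ((sylvesterU i : ℝ) + 1) - 1)) :=
          (Real.exp_sum _ _).symm
      _ ≤ 1 := by
          rw [Real.exp_le_one_iff]
          have := (Rat.cast_le (K := ℝ)).mpr hsum
          push_cast at this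
          exact this
  rw [Finset.prod_div_distrib, div_le_one (Finset.prod_pos fun _ _ => by positivity)] at hprod
  have : ∏ i ∈ Finset.range (m + 1), a i ≤ sylvesterU (m + 1) := by
    rw [← prod_sylvesterU_add_one (m + 1)]
    exact_mod_cast hprod
  have : (∏ i ∈ Finset.range (m + 1), (a i : ℚ)) ≤ (sylvesterU (m + 1) : ℚ) := by
    exact_mod_cast this
  linarith

/-! ### Counting the representations of `1` -/

/-- The first `k` terms of `a` are a nondecreasing Egyptian fraction representation of `1`. -/
def IsUnitRep (k : ℕ) (a : ℕ → ℕ) : Prop :=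
  (∀ i < k, 0 < a i) ∧ (∀ i, i + 1 < k → a i ≤ a (i + 1)) ∧
    ∑ i ∈ Finset.range k, 1 / (a i : ℚ) = 1

namespace IsUnitRep

variable {k : ℕ} {a : ℕ → ℕ}

theorem le_of_le (h : IsUnitRep k a) {i l : ℕ} (hil : i ≤ l) (hl : l < k) : a i ≤ a l := by
  induction l, hil using Nat.le_induction with
  | base => rfl
  | succ l _ ih => exact (ih (by omega)).trans (h.2.1 l hl)

theorem one_sub_sum_eq (h : IsUnitRep k a) {n : ℕ} (hn : n ≤ k) :
    1 - ∑ i ∈ Finset.range n, 1 / (a i : ℚ) = ∑ i ∈ Finset.Ico n k, 1 / (a i : ℚ) := by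
  rw [sub_eq_iff_eq_add', Finset.sum_range_add_sum_Ico _ hn, h.2.2]

theorem one_sub_sum_pos (h : IsUnitRep k a) {n : ℕ} (hn : n < k) :
    0 < 1 - ∑ i ∈ Finset.range n, 1 / (a i : ℚ) := by
  rw [h.one_sub_sum_eq hn.le]
  refine Finset.sum_pos (fun i hi => ?_) ⟨n, by simpa using hn⟩
  have : (0 : ℚ) < a i := by exact_mod_cast h.1 i (Finset.mem_Ico.mp hi).2
  positivity

theorem one_sub_sum_mul_le (h : IsUnitRep k a) {n : ℕ} (hn : n < k) :
    (1 - ∑ i ∈ Finset.range n, 1 / (a i : ℚ)) * a n ≤ ((k - n : ℕ) : ℚ) := by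
  have han : (0 : ℚ) < a n := by exact_mod_cast h.1 n hn
  rw [h.one_sub_sum_eq hn.le, Finset.sum_mul]
  calc _ ≤ ∑ i ∈ Finset.Ico n k, (1 : ℚ) := Finset.sum_le_sum fun i hi => by
        obtain ⟨h1, h2⟩ := Finset.mem_Ico.mp hi
        have h3 : (a n : ℚ) ≤ a i := by exact_mod_cast h.le_of_le h1 h2
        rw [one_div_mul_eq_div]
        exact div_le_one_of_le₀ h3 (by positivity)
    _ = _ := by simp

/-- The remainder before `a n` is at least `1 / u_n`, and is a sum of `k - n` terms each at most `1
/ a n`. -/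
theorem apply_le (h : IsUnitRep k a) {n : ℕ} (hn : n < k) : a n ≤ k * sylvesterU n := by
  have h1 := one_div_sylvesterU_le (fun i hi => h.1 i (by omega))
    (fun i hi => h.2.1 i (by omega)) (n := n) (by linarith [h.one_sub_sum_pos hn])
  have h2 := h.one_sub_sum_mul_le hn
  have hu : (0 : ℚ) < sylvesterU n := by exact_mod_cast sylvesterU_pos n
  have h3 : 1 / (sylvesterU n : ℚ) * a n ≤ k :=
    (mul_le_mul_of_nonneg_right h1 (by positivity)).trans
      (h2.trans (by exact_mod_cast Nat.sub_le k n))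
  rw [one_div_mul_eq_div, div_le_iff₀ hu] at h3
  exact_mod_cast h3

theorem prod_le (h : IsUnitRep k a) {n : ℕ} (hn : n ≤ k) :
    ∏ i ∈ Finset.range n, a i ≤ k ^ n * sylvesterU n := by
  calc _ ≤ ∏ i ∈ Finset.range n, k * sylvesterU i :=
        Finset.prod_le_prod' fun i hi => h.apply_le (by simp at hi; omega)
    _ = k ^ n * ∏ i ∈ Finset.range n, sylvesterU i := by simp [Finset.prod_mul_distrib]
    _ ≤ _ := Nat.mul_le_mul_left _ (prod_sylvesterU_le n)

theorem prod_pos (h : IsUnitRep k a) {n : ℕ} (hn : n ≤ k) :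
    0 < ∏ i ∈ Finset.range n, a i :=
  Finset.prod_pos fun i hi => h.1 i (by simp at hi; omega)

theorem remainderNum_pos (h : IsUnitRep k a) {n : ℕ} (hn : n < k) : 0 < remainderNum a n := by
  have h1 := remainderNum_eq (a := a) (n := n) fun i hi => h.1 i (by omega)
  have h2 : (0 : ℚ) < ∏ i ∈ Finset.range n, (a i : ℚ) := by exact_mod_cast h.prod_pos hn.le
  have h3 : (0 : ℚ) < remainderNum a n := by rw [h1]; exact mul_pos h2 (h.one_sub_sum_pos hn)
  exact_mod_cast h3

theorem remainderNum_self (h : IsUnitRep k a) : remainderNum a k = 0 := by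
  have h1 := remainderNum_eq h.1
  rw [h.2.2, sub_self, mul_zero] at h1
  exact_mod_cast h1

theorem remainderNum_mul_le (h : IsUnitRep k a) {n : ℕ} (hn : n < k) :
    remainderNum a n * a n ≤ ((k - n : ℕ) : ℤ) * ((∏ i ∈ Finset.range n, a i : ℕ) : ℤ) := by
  have h1 := remainderNum_eq (a := a) (n := n) fun i hi => h.1 i (by omega)
  have h2 : (0 : ℚ) < ∏ i ∈ Finset.range n, (a i : ℚ) := by exact_mod_cast h.prod_pos hn.le
  have h3 : (remainderNum a n : ℚ) * a n ≤
      ((k - n : ℕ) : ℚ) * ∏ i ∈ Finset.range n, (a i : ℚ) := by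
    rw [h1, mul_assoc, mul_comm ((k - n : ℕ) : ℚ)]
    exact mul_le_mul_of_nonneg_left (h.one_sub_sum_mul_le hn) h2.le
  exact_mod_cast h3

end IsUnitRep

theorem remainderNum_succ (a : ℕ → ℕ) (n : ℕ) :
    remainderNum a (n + 1) = remainderNum a n * a n - ((∏ i ∈ Finset.range n, a i : ℕ) : ℤ) := by
  rw [remainderNum]; push_cast; rfl

/-- Keep the first `n` terms of a sequence and replace the others by `0`. -/
def truncSeq (n : ℕ) (a : ℕ → ℕ) : ℕ → ℕ := fun i => if i < n then a i else 0

theorem truncSeq_apply {n i : ℕ} (a : ℕ → ℕ) (h : i < n) : truncSeq n a i = a i := if_pos h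

theorem truncSeq_eq_iff {n : ℕ} {a b : ℕ → ℕ} :
    truncSeq n a = truncSeq n b ↔ ∀ i < n, a i = b i := by
  constructor
  · intro h i hi
    rw [← truncSeq_apply a hi, h, truncSeq_apply b hi]
  · intro h
    funext i
    by_cases hi : i < n
    · rw [truncSeq_apply a hi, truncSeq_apply b hi, h i hi]
    · simp [truncSeq, hi]

/-! ### Counting by fibres of truncation -/

section Count

variable {j N D : ℕ} {a : ℕ → ℕ}

/-- Four terms remain at index `j` and three at `j + 1`, so `a_j ≤ 4 P_j` and `R_{j+1} a_{j+1} ≤ 3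
P_{j+1}`, where `P_j ≤ N`. -/
theorem IsUnitRep.bounds (h : IsUnitRep (j + 4) a) (hN : (j + 4) ^ j * sylvesterU j ≤ N) :
    (remainderNum a (j + 1) * a (j + 1)).toNat ≤ 12 * N ^ 2 ∧
      ∏ i ∈ Finset.range (j + 2), a i ≤ 48 * N ^ 4 := by
  have hP := (h.prod_le (n := j) (by omega)).trans hN
  have hR := h.remainderNum_pos (n := j) (by omega)
  have hR1 := h.remainderNum_pos (n := j + 1) (by omega)
  have h0 := h.remainderNum_mul_le (n := j) (by omega)
  have h1 := h.remainderNum_mul_le (n := j + 1) (by omega)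
  rw [show j + 4 - j = 4 by omega] at h0
  rw [show j + 4 - (j + 1) = 3 by omega, Finset.prod_range_succ] at h1
  rw [Finset.prod_range_succ, Finset.prod_range_succ]
  set P := ∏ i ∈ Finset.range j, a i
  have hx : a j ≤ 4 * P := by
    have : (a j : ℤ) ≤ 4 * P := by push_cast at h0; nlinarith
    exact_mod_cast this
  have hxN : P * a j ≤ 4 * N ^ 2 := by
    calc P * a j ≤ N * (4 * N) := Nat.mul_le_mul hP (hx.trans (by omega))
      _ = _ := by ring
  have hxN' : ((P * a j : ℕ) : ℤ) ≤ 4 * N ^ 2 := by exact_mod_cast hxN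
  have ht : remainderNum a (j + 1) * a (j + 1) ≤ 12 * (N : ℤ) ^ 2 := by
    calc _ ≤ _ := h1
      _ ≤ (3 : ℤ) * (4 * N ^ 2) := mul_le_mul_of_nonneg_left hxN' (by norm_num)
      _ = _ := by ring
  refine ⟨by rw [Int.toNat_le]; exact_mod_cast ht, ?_⟩
  have hy : a (j + 1) ≤ 12 * N ^ 2 := by
    have : (a (j + 1) : ℤ) ≤ 12 * (N : ℤ) ^ 2 := by nlinarith
    exact_mod_cast this
  calc P * a j * a (j + 1) ≤ 4 * N ^ 2 * (12 * N ^ 2) := Nat.mul_le_mul hxN hy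
    _ = _ := by ring

/-- Once all but two denominators are fixed, the last two come from a divisor of a square. -/
theorem card_fiber_two_le [DecidableEq (ℕ → ℕ)] {k : ℕ} {S : Finset (ℕ → ℕ)}
    (hS : ∀ a ∈ S, IsUnitRep (k + 2) a ∧ truncSeq (k + 2) a = a) (b : ℕ → ℕ) :
    (S.filter fun a => truncSeq k a = b).card ≤
      ((∏ i ∈ Finset.range k, b i) ^ 2).divisors.card := by
  have hagree : ∀ a ∈ S.filter (fun a => truncSeq k a = b), ∀ i < k, a i = b i := by
    intro a ha i hi
    rw [← (Finset.mem_filter.mp ha).2, truncSeq_apply a hi]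
  have hprod : ∀ a ∈ S.filter (fun a => truncSeq k a = b),
      ∏ i ∈ Finset.range k, a i = ∏ i ∈ Finset.range k, b i := fun a ha =>
    Finset.prod_congr rfl fun i hi => hagree a ha i (by simpa using hi)
  have key : ∀ a ∈ S, 0 < remainderNum a (k + 1) ∧
      remainderNum a (k + 1) * a (k + 1) =
        ((∏ i ∈ Finset.range k, a i : ℕ) : ℤ) * a k := by
    intro a ha
    have h := (hS a ha).1
    refine ⟨h.remainderNum_pos (by omega), ?_⟩
    have h2 := h.remainderNum_self
    rw [remainderNum_succ, Finset.prod_range_succ] at h2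
    push_cast at h2 ⊢
    linarith
  refine Finset.card_le_card_of_injOn (fun a => (remainderNum a (k + 1)).toNat) ?_ ?_
  · intro a ha
    have haS := (Finset.mem_filter.mp ha).1
    have h := (hS a haS).1
    obtain ⟨h1, h2⟩ := key a haS
    have h3 := remainderNum_succ a k
    have hP := h.prod_pos (n := k) (by omega)
    rw [Finset.mem_coe, Nat.mem_divisors, ← hprod a ha]
    refine ⟨?_, by positivity⟩
    rw [← Int.natCast_dvd_natCast, Int.toNat_of_nonneg h1.le]
    -- With `R_{k+2} = 0`, the factorization is `R_{k+1} (R_k a_{k+1} - P_k) = P_k ^ 2`.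
    refine ⟨remainderNum a k * a (k + 1) - ((∏ i ∈ Finset.range k, a i : ℕ) : ℤ), ?_⟩
    rw [mul_sub, mul_left_comm, h2, h3]
    push_cast
    ring
  · intro a ha a' ha' heq
    have haS := (Finset.mem_filter.mp ha).1
    have haS' := (Finset.mem_filter.mp ha').1
    obtain ⟨h1, h2⟩ := key a haS
    obtain ⟨h1', h2'⟩ := key a' haS'
    have hR1 : remainderNum a (k + 1) = remainderNum a' (k + 1) := by
      have := congrArg (Nat.cast : ℕ → ℤ) heq
      simpa only [Int.toNat_of_nonneg h1.le, Int.toNat_of_nonneg h1'.le] using this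
    have hag : ∀ i < k, a i = a' i := fun i hi => by rw [hagree a ha i hi, hagree a' ha' i hi]
    have hP : ∏ i ∈ Finset.range k, a i = ∏ i ∈ Finset.range k, a' i := by
      rw [hprod a ha, hprod a' ha']
    have hk : a k = a' k := by
      have h3 := hR1
      rw [remainderNum_succ, remainderNum_succ, hP, ← remainderNum_congr hag] at h3
      have h4 := (hS a haS).1.remainderNum_pos (n := k) (by omega)
      have h5 : (a k : ℤ) = a' k := mul_left_cancel₀ h4.ne' (by linarith)
      exact_mod_cast h5
    have hk1 : a (k + 1) = a' (k + 1) := by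
      rw [← hR1, ← hk, ← hP, ← h2] at h2'
      exact_mod_cast (mul_left_cancel₀ h1.ne' h2').symm
    rw [← (hS a haS).2, ← (hS a' haS').2, truncSeq_eq_iff]
    intro i hi
    rcases Nat.lt_or_ge i k with h | h
    · exact hag i h
    · obtain rfl | rfl : i = k ∨ i = k + 1 := by omega
      · exact hk
      · exact hk1

/-- The prefix fixes `R_j` and `P_j`, so the divisor `R_{j+1} = R_j a_j - P_j` of `t` recovers
`a_j`, and then `a_{j+1} = t / R_{j+1}`. -/
theorem card_fiber_remainder_le {T : Finset (ℕ → ℕ)}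
    (hT : ∀ b ∈ T, ∃ a, IsUnitRep (j + 4) a ∧ truncSeq (j + 2) a = b)
    (c : Fin j → ℕ) (t : ℕ) :
    (T.filter fun b => ((fun i : Fin j => b i,
      (remainderNum b (j + 1) * b (j + 1)).toNat) : (Fin j → ℕ) × ℕ) = (c, t)).card ≤
      t.divisors.card := by
  have key : ∀ b ∈ T, 0 < b (j + 1) ∧ 0 < remainderNum b j ∧ 0 < remainderNum b (j + 1) := by
    intro b hb
    obtain ⟨a, ha, rfl⟩ := hT b hb
    have hc : ∀ n ≤ j + 2, remainderNum (truncSeq (j + 2) a) n = remainderNum a n :=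
      fun n hn => remainderNum_congr fun i hi => truncSeq_apply a (by omega)
    rw [truncSeq_apply a (by omega), hc j (by omega), hc (j + 1) (by omega)]
    exact ⟨ha.1 _ (by omega), ha.remainderNum_pos (by omega), ha.remainderNum_pos (by omega)⟩
  refine Finset.card_le_card_of_injOn (fun b => (remainderNum b (j + 1)).toNat) ?_ ?_
  · intro b hb
    obtain ⟨hbT, hbe⟩ := Finset.mem_filter.mp hb
    obtain ⟨h0, -, h1⟩ := key b hbT
    have ht := (Prod.mk.inj hbe).2
    have h0' : (0 : ℤ) < b (j + 1) := by exact_mod_cast h0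
    have hpos : 0 < remainderNum b (j + 1) * b (j + 1) := mul_pos h1 h0'
    rw [Finset.mem_coe, Nat.mem_divisors, ← ht]
    refine ⟨?_, by omega⟩
    rw [← Int.natCast_dvd_natCast, Int.toNat_of_nonneg h1.le, Int.toNat_of_nonneg hpos.le]
    exact dvd_mul_right _ _
  · intro b hb b' hb' heq
    obtain ⟨hbT, hbe⟩ := Finset.mem_filter.mp hb
    obtain ⟨hbT', hbe'⟩ := Finset.mem_filter.mp hb'
    obtain ⟨h0, hr, h1⟩ := key b hbT
    obtain ⟨h0', -, h1'⟩ := key b' hbT'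
    have hR1 : remainderNum b (j + 1) = remainderNum b' (j + 1) := by
      have := congrArg (Nat.cast : ℕ → ℤ) heq
      simpa only [Int.toNat_of_nonneg h1.le, Int.toNat_of_nonneg h1'.le] using this
    have hpair := hbe.trans hbe'.symm
    have hag : ∀ i < j, b i = b' i := fun i hi => congrFun (Prod.mk.inj hpair).1 ⟨i, hi⟩
    have hj : b j = b' j := by
      have h3 := hR1
      rw [remainderNum_succ, remainderNum_succ, ← remainderNum_congr hag,
        Finset.prod_congr rfl fun i hi => hag i (by simpa using hi)] at h3
      have h5 : (b j : ℤ) = b' j := mul_left_cancel₀ hr.ne' (by linarith)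
      exact_mod_cast h5
    have hj1 : b (j + 1) = b' (j + 1) := by
      have h3 := (Prod.mk.inj hpair).2
      have h4 : remainderNum b (j + 1) * b (j + 1) = remainderNum b' (j + 1) * b' (j + 1) := by
        have e1 : 0 ≤ remainderNum b (j + 1) * b (j + 1) := by positivity
        have e2 : 0 ≤ remainderNum b' (j + 1) * b' (j + 1) := by positivity
        omega
      rw [← hR1] at h4
      exact_mod_cast mul_left_cancel₀ h1.ne' h4
    obtain ⟨a, -, rfl⟩ := hT b hbT
    obtain ⟨a', -, rfl⟩ := hT b' hbT'
    rw [truncSeq_eq_iff]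
    intro i hi
    have hmain : truncSeq (j + 2) a i = truncSeq (j + 2) a' i := by
      rcases Nat.lt_or_ge i j with h | h
      · exact hag i h
      · obtain rfl | rfl : i = j ∨ i = j + 1 := by omega
        · exact hj
        · exact hj1
    rwa [truncSeq_apply a hi, truncSeq_apply a' hi] at hmain

theorem card_isUnitRep_le {S : Finset (ℕ → ℕ)}
    (hS : ∀ a ∈ S, IsUnitRep (j + 4) a ∧ truncSeq (j + 4) a = a)
    (hN : (j + 4) ^ j * sylvesterU j ≤ N)
    (hD : ∀ q, q ≠ 0 → q ≤ 2304 * N ^ 8 → q.divisors.card ≤ D) :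
    S.card ≤ D * (D * (N * (12 * N ^ 2 + 1))) := by
  classical
  have hN0 : 0 < N := lt_of_lt_of_le (Nat.mul_pos (by positivity) (sylvesterU_pos j)) hN
  set T := S.image (truncSeq (j + 2)) with hT
  have hTmem : ∀ b ∈ T, ∃ a, IsUnitRep (j + 4) a ∧ truncSeq (j + 2) a = b := by
    intro b hb
    obtain ⟨a, ha, rfl⟩ := Finset.mem_image.mp hb
    exact ⟨a, (hS a ha).1, rfl⟩
  have hrem : ∀ a : ℕ → ℕ, remainderNum (truncSeq (j + 2) a) (j + 1) *
      truncSeq (j + 2) a (j + 1) = remainderNum a (j + 1) * a (j + 1) := by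
    intro a
    rw [truncSeq_apply a (by omega), remainderNum_congr (b := a) fun i hi =>
      truncSeq_apply a (by omega)]
  have h1 : S.card ≤ D * T.card := by
    refine Finset.card_le_mul_card_image S D fun b hb => ?_
    refine (card_fiber_two_le (k := j + 2) hS b).trans ?_
    obtain ⟨a, ha, rfl⟩ := hTmem b hb
    have hp : ∏ i ∈ Finset.range (j + 2), truncSeq (j + 2) a i =
        ∏ i ∈ Finset.range (j + 2), a i :=
      Finset.prod_congr rfl fun i hi => truncSeq_apply a (by simpa using hi)
    rw [hp]
    have hpos := ha.prod_pos (n := j + 2) (by omega)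
    refine hD _ (by positivity) ?_
    calc _ ≤ (48 * N ^ 4) ^ 2 := Nat.pow_le_pow_left (ha.bounds hN).2 2
      _ = _ := by ring
  set f : (ℕ → ℕ) → (Fin j → ℕ) × ℕ := fun b =>
    (fun i : Fin j => b i, (remainderNum b (j + 1) * b (j + 1)).toNat) with hf
  have h2 : T.card ≤ D * (T.image f).card := by
    refine Finset.card_le_mul_card_image T D fun p hp => ?_
    refine (card_fiber_remainder_le hTmem p.1 p.2).trans ?_
    obtain ⟨b, hb, rfl⟩ := Finset.mem_image.mp hp
    obtain ⟨a, ha, rfl⟩ := hTmem b hb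
    simp only [hf, hrem]
    have hpos : 0 < remainderNum a (j + 1) * a (j + 1) :=
      mul_pos (ha.remainderNum_pos (by omega)) (by exact_mod_cast ha.1 _ (by omega))
    refine hD _ (by omega) ((ha.bounds hN).1.trans ?_)
    have : N ^ 2 ≤ N ^ 8 := Nat.pow_le_pow_right hN0 (by norm_num)
    omega
  have h3 : (T.image f).card ≤ N * (12 * N ^ 2 + 1) := by
    calc (T.image f).card
        ≤ ((Fintype.piFinset fun i : Fin j => Finset.Icc 1 ((j + 4) * sylvesterU i)) ×ˢ
            Finset.range (12 * N ^ 2 + 1)).card := by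
          refine Finset.card_le_card fun p hp => ?_
          obtain ⟨b, hb, rfl⟩ := Finset.mem_image.mp hp
          obtain ⟨a, ha, rfl⟩ := hTmem b hb
          simp only [hf, hrem, Finset.mem_product, Fintype.mem_piFinset, Finset.mem_Icc,
            Finset.mem_range]
          refine ⟨fun i => ?_, Nat.lt_succ_of_le (ha.bounds hN).1⟩
          have hi := i.2
          rw [truncSeq_apply a (by omega)]
          exact ⟨ha.1 _ (by omega), ha.apply_le (by omega)⟩
      _ = (j + 4) ^ j * (∏ i ∈ Finset.range j, sylvesterU i) * (12 * N ^ 2 + 1) := by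
          rw [Finset.card_product, Fintype.card_piFinset, Finset.card_range]
          simp [Finset.prod_mul_distrib, Finset.prod_range]
      _ ≤ N * (12 * N ^ 2 + 1) :=
          Nat.mul_le_mul_right _ ((Nat.mul_le_mul_left _ (prod_sylvesterU_le j)).trans hN)
  exact h1.trans (Nat.mul_le_mul_left _ (h2.trans (Nat.mul_le_mul_left _ h3)))

end Count

/-! ### Tuples indexed by `Fin k` -/

/-- Extension of a tuple by `0`. -/
def extendTuple {k : ℕ} (a : Fin k → ℕ) : ℕ → ℕ := fun i => if h : i < k then a ⟨i, h⟩ else 0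

theorem extendTuple_apply {k : ℕ} (a : Fin k → ℕ) (i : Fin k) : extendTuple a i = a i := by
  simp [extendTuple]

theorem extendTuple_injective (k : ℕ) : Function.Injective (extendTuple (k := k)) := by
  intro a b h
  funext i
  rw [← extendTuple_apply a, h, extendTuple_apply]

theorem truncSeq_extendTuple {k : ℕ} (a : Fin k → ℕ) :
    truncSeq k (extendTuple a) = extendTuple a := by
  funext i
  by_cases h : i < k <;> simp [truncSeq, extendTuple, h]

theorem isUnitRep_extendTuple {k : ℕ} {a : Fin k → ℕ} (h : a ∈ unitFractionReps k 1 1) :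
    IsUnitRep k (extendTuple a) := by
  obtain ⟨h1, h2, h3⟩ := h
  refine ⟨fun i hi => ?_, fun i hi => ?_, ?_⟩
  · rw [extendTuple_apply a ⟨i, hi⟩]; exact h1 _
  · rw [extendTuple_apply a ⟨i, by omega⟩, extendTuple_apply a ⟨i + 1, hi⟩]
    exact h2 (by simp)
  · rw [Finset.sum_range]
    simp only [extendTuple_apply]
    simpa using h3.symm

theorem finite_unitFractionReps_one_one (k : ℕ) : (unitFractionReps k 1 1).Finite := by
  refine (Finset.finite_toSet
    (Fintype.piFinset fun i : Fin k => Finset.range (k * sylvesterU i + 1))).subset fun a ha => ?_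
  simp only [Finset.mem_coe, Fintype.mem_piFinset, Finset.mem_range]
  intro i
  have := (isUnitRep_extendTuple ha).apply_le i.2
  rw [extendTuple_apply] at this
  omega

theorem numUnitFractionReps_one_one_le {j N D : ℕ}
    (hN : (j + 4) ^ j * sylvesterU j ≤ N)
    (hD : ∀ q, q ≠ 0 → q ≤ 2304 * N ^ 8 → q.divisors.card ≤ D) :
    numUnitFractionReps (j + 4) 1 1 ≤ D * (D * (N * (12 * N ^ 2 + 1))) := by
  classical
  have hfin := finite_unitFractionReps_one_one (j + 4)
  rw [numUnitFractionReps, Set.ncard_eq_toFinset_card _ hfin,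
    ← Finset.card_image_of_injective _ (extendTuple_injective (j + 4))]
  refine card_isUnitRep_le (fun a ha => ?_) hN hD
  obtain ⟨b, hb, rfl⟩ := Finset.mem_image.mp ha
  exact ⟨isUnitRep_extendTuple (by simpa using hb), truncSeq_extendTuple b⟩

/-! ### The equation with the product term -/

/-- The product is appended as one more denominator and the result sorted; the permutation remembers
the original order. -/
theorem exists_perm_of_mem_productSolutions {k : ℕ} {a : Fin k → ℕ} (h : a ∈ productSolutions k) :
    ∃ p : (Fin (k + 1) → ℕ) × Equiv.Perm (Fin (k + 1)),
      p.1 ∈ unitFractionReps (k + 1) 1 1 ∧ ∀ i, a i = p.1 (p.2 (Fin.castSucc i)) := by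
  obtain ⟨h1, h2⟩ := h
  set b : Fin (k + 1) → ℕ := Fin.snoc (α := fun _ => ℕ) a (∏ i, a i) with hb
  refine ⟨(b ∘ Tuple.sort b, (Tuple.sort b)⁻¹), ⟨fun i => ?_, Tuple.monotone_sort b, ?_⟩, ?_⟩
  · have : ∀ i, 0 < b i := by
      intro i
      refine Fin.lastCases ?_ (fun i => ?_) i
      · simp only [hb, Fin.snoc_last]
        exact Finset.prod_pos fun i _ => h1 i
      · simpa [hb] using h1 i
    exact this _
  · have : ∑ i, 1 / ((b ∘ Tuple.sort b) i : ℚ) = ∑ i, 1 / (b i : ℚ) :=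
      Equiv.sum_comp (Tuple.sort b) fun i => 1 / (b i : ℚ)
    rw [this, Fin.sum_univ_castSucc]
    simp only [hb, Fin.snoc_castSucc, Fin.snoc_last]
    push_cast
    rw [← h2]
    norm_num
  · intro i
    simp [hb]

theorem finite_productSolutions_and_ncard_le (k : ℕ) :
    (productSolutions k).Finite ∧
      (productSolutions k).ncard ≤ numUnitFractionReps (k + 1) 1 1 * (k + 1).factorial := by
  classical
  have hfin := finite_unitFractionReps_one_one (k + 1)
  set g : (Fin (k + 1) → ℕ) × Equiv.Perm (Fin (k + 1)) → (Fin k → ℕ) :=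
    fun p i => p.1 (p.2 (Fin.castSucc i))
  have hfin' : (unitFractionReps (k + 1) 1 1 ×ˢ
      (Set.univ : Set (Equiv.Perm (Fin (k + 1))))).Finite := hfin.prod Set.finite_univ
  have hsub : productSolutions k ⊆ g '' (unitFractionReps (k + 1) 1 1 ×ˢ
      (Set.univ : Set (Equiv.Perm (Fin (k + 1))))) := fun a ha => by
    obtain ⟨p, hp, hpa⟩ := exists_perm_of_mem_productSolutions ha
    exact ⟨p, ⟨hp, Set.mem_univ _⟩, funext fun i => (hpa i).symm⟩
  refine ⟨(hfin'.image g).subset hsub, ?_⟩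
  calc _ ≤ _ := Set.ncard_le_ncard hsub (hfin'.image g)
    _ ≤ _ := Set.ncard_image_le hfin'
    _ = _ := by
      rw [Set.ncard_prod, Set.ncard_univ, Nat.card_eq_fintype_card, Fintype.card_perm,
        Fintype.card_fin, numUnitFractionReps]

/-! ### Asymptotics -/

/-- The added 1 closes the induction: `u² + u + 1 ≤ (u + 1)²`. -/
theorem sylvesterU_add_one_le (n : ℕ) : sylvesterU n + 1 ≤ 2 ^ 2 ^ n := by
  induction n with
  | zero => simp [sylvesterU]
  | succ n ih =>
    rw [sylvesterU, pow_succ 2 n, pow_mul]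
    nlinarith [Nat.pow_le_pow_left ih 2]

theorem exists_tendsto_sylvesterU : ∃ c : ℝ,
    Filter.Tendsto (fun n : ℕ => (sylvesterU n : ℝ) ^ (1 / (2 : ℝ) ^ n)) Filter.atTop (nhds c) ∧
      1 < c ∧ c ≤ 2 ∧ ∀ n, (sylvesterU n : ℝ) ≤ c ^ 2 ^ n := by
  set v : ℕ → ℝ := fun n => (sylvesterU n : ℝ) ^ (1 / (2 : ℝ) ^ n) with hv
  have hpow : ∀ (n : ℕ) (x : ℝ), 0 ≤ x → (x ^ (1 / (2 : ℝ) ^ n)) ^ 2 ^ n = x := by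
    intro n x hx
    rw [← Real.rpow_natCast, ← Real.rpow_mul hx]
    push_cast
    rw [one_div_mul_cancel (by positivity), Real.rpow_one]
  have hv0 : ∀ n, 0 ≤ v n := fun n => by positivity
  -- This is `u_{n+1} ≥ u_n²` after taking roots; the limit is therefore the supremum.
  have hmono : Monotone v := monotone_nat_of_le_succ fun n => by
    refine le_of_pow_le_pow_left₀ (n := 2 ^ (n + 1)) (by positivity) (hv0 _) ?_
    rw [hpow _ _ (by positivity), pow_succ 2 n, pow_mul, hpow _ _ (by positivity), sylvesterU]
    push_cast
    nlinarith [(by positivity : (0 : ℝ) ≤ sylvesterU n)]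
  have hle : ∀ n, v n ≤ 2 := fun n => by
    refine le_of_pow_le_pow_left₀ (n := 2 ^ n) (by positivity) (by norm_num) ?_
    rw [hpow _ _ (by positivity)]
    exact_mod_cast (Nat.le_succ _).trans (sylvesterU_add_one_le n)
  have hbdd : BddAbove (Set.range v) := ⟨2, by rintro _ ⟨n, rfl⟩; exact hle n⟩
  have hu : ∀ n, (sylvesterU n : ℝ) ≤ (⨆ n, v n) ^ 2 ^ n := fun n => by
    rw [← hpow n (sylvesterU n) (by positivity)]
    exact pow_le_pow_left₀ (hv0 n) (le_ciSup hbdd n) _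
  refine ⟨⨆ n, v n, tendsto_atTop_ciSup hmono hbdd, ?_, ciSup_le hle, hu⟩
  have h1 := hu 1
  norm_num [sylvesterU] at h1
  have h0 : 0 ≤ ⨆ n, v n := (hv0 0).trans (le_ciSup hbdd 0)
  nlinarith

/-- The exponent is `3 + 2/25`: two divisor bounds with `δ = 1/200`, each applied up to a multiple
of `N ^ 8`, contribute `2 · 8/200`. -/
theorem exists_numUnitFractionReps_le_rpow : ∃ C : ℝ, 0 < C ∧ ∀ j : ℕ,
    (numUnitFractionReps (j + 4) 1 1 : ℝ) ≤
      C * (((j + 4) ^ j * sylvesterU j : ℕ) : ℝ) ^ (77 / 25 : ℝ) := by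
  obtain ⟨C, hC1, hC⟩ := exists_card_divisors_le_rpow (δ := 1 / 200) (by norm_num)
  have hC0 : 0 < C := by linarith
  refine ⟨C ^ 2 * ((2304 : ℝ) ^ (1 / 200 : ℝ)) ^ 2 * 13, by positivity, fun j => ?_⟩
  set N := (j + 4) ^ j * sylvesterU j with hN
  have hN1 : 1 ≤ N := Nat.mul_pos (by positivity) (sylvesterU_pos j)
  have hNr : (1 : ℝ) ≤ N := by exact_mod_cast hN1
  set E : ℝ := C * (2304 * (N : ℝ) ^ 8) ^ (1 / 200 : ℝ) with hE
  have hE0 : 0 ≤ E := by positivity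
  have hD : ∀ q, q ≠ 0 → q ≤ 2304 * N ^ 8 → q.divisors.card ≤ ⌊E⌋₊ := by
    intro q hq hqN
    refine Nat.le_floor ((hC q hq).trans ?_)
    have : (q : ℝ) ≤ 2304 * (N : ℝ) ^ 8 := by exact_mod_cast hqN
    rw [hE]
    gcongr
  have h := numUnitFractionReps_one_one_le le_rfl hD
  rw [← hN] at h
  have hfl : (⌊E⌋₊ : ℝ) ≤ E := Nat.floor_le hE0
  have hN3 : (N : ℝ) * (12 * (N : ℝ) ^ 2 + 1) ≤ 13 * (N : ℝ) ^ 3 := by nlinarith [sq_nonneg ((N : ℝ))]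
  calc (numUnitFractionReps (j + 4) 1 1 : ℝ)
      ≤ ⌊E⌋₊ * (⌊E⌋₊ * ((N : ℝ) * (12 * (N : ℝ) ^ 2 + 1))) := by exact_mod_cast h
    _ ≤ E * (E * (13 * (N : ℝ) ^ 3)) := by gcongr
    _ = C ^ 2 * ((2304 : ℝ) ^ (1 / 200 : ℝ)) ^ 2 * 13 *
        ((((N : ℝ) ^ 8) ^ (1 / 200 : ℝ)) ^ 2 * (N : ℝ) ^ 3) := by
        rw [hE, Real.mul_rpow (by norm_num) (by positivity)]
        ring
    _ = _ := by
        congr 1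
        rw [← Real.rpow_natCast, ← Real.rpow_natCast, ← Real.rpow_natCast,
          ← Real.rpow_mul (by positivity), ← Real.rpow_mul (by positivity),
          ← Real.rpow_add (by positivity)]
        norm_num

theorem eventually_const_mul_pow_lt {C c : ℝ} (hC : 0 < C) (hc : 1 < c) :
    ∀ᶠ k : ℕ in Filter.atTop,
      C * (k : ℝ) ^ (5 * k) < c ^ ((1 / 200 : ℝ) * 2 ^ k) := by
  have hlc : 0 < Real.log c := Real.log_pos hc
  set A := |Real.log C| + 5 with hA
  have hA0 : 0 < A := by positivity
  have hlim := tendsto_pow_const_div_const_pow_of_one_lt 2 (r := (2 : ℝ)) (by norm_num)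
  have hev := hlim.eventually (gt_mem_nhds (show 0 < 1 / 200 * Real.log c / A by positivity))
  filter_upwards [hev, Filter.eventually_ge_atTop 1] with k hk hk1
  have hk0 : (1 : ℝ) ≤ k := by exact_mod_cast hk1
  rw [← Real.log_lt_log_iff (by positivity) (by positivity), Real.log_mul (by positivity)
    (by positivity), Real.log_pow, Real.log_rpow (by linarith)]
  rw [div_lt_div_iff₀ (by positivity) hA0] at hk
  have h1 : Real.log k ≤ k := (Real.log_le_sub_one_of_pos (by positivity)).trans (by linarith)
  have h2 : Real.log C ≤ |Real.log C| * (k : ℝ) ^ 2 :=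
    (le_abs_self _).trans (le_mul_of_one_le_right (abs_nonneg _) (one_le_pow₀ hk0))
  push_cast
  calc Real.log C + 5 * k * Real.log k ≤ |Real.log C| * (k : ℝ) ^ 2 + 5 * k * k := by gcongr
    _ = (k : ℝ) ^ 2 * A := by rw [hA]; ring
    _ < _ := hk
    _ = _ := by ring

/-- The factor `k ^ k` is there to dominate the `k!` orderings in the product equation. In units of
`2 ^ j`, the exponents are `77/25 + 16/200 = 79/25`, below the target `16/5`. -/
theorem exists_numUnitFractionReps_mul_pow_lt {c : ℝ} (hc : 1 < c)
    (hu : ∀ n, (sylvesterU n : ℝ) ≤ c ^ 2 ^ n) :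
    ∃ K : ℕ, ∀ k : ℕ, K ≤ k →
      (numUnitFractionReps k 1 1 : ℝ) * (k : ℝ) ^ k < c ^ ((2 / 5 : ℝ) * 2 ^ (k - 1)) := by
  obtain ⟨C, hC, hf⟩ := exists_numUnitFractionReps_le_rpow
  obtain ⟨K, hK⟩ := Filter.eventually_atTop.mp (eventually_const_mul_pow_lt hC hc)
  refine ⟨K + 4, fun k hk => ?_⟩
  obtain ⟨j, rfl⟩ : ∃ j, k = j + 4 := ⟨k - 4, by omega⟩
  have hlt := hK (j + 4) (by omega)
  set x : ℝ := ((j + 4 : ℕ) : ℝ) with hx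
  have hx1 : 1 ≤ x := by rw [hx]; exact_mod_cast Nat.succ_pos _
  have hpow : ((x ^ j) ^ (77 / 25 : ℝ)) ≤ x ^ (4 * (j + 4)) := by
    rw [← Real.rpow_natCast, ← Real.rpow_mul (by positivity), ← Real.rpow_natCast]
    refine Real.rpow_le_rpow_of_exponent_le hx1 ?_
    push_cast
    nlinarith [(Nat.cast_nonneg j : (0 : ℝ) ≤ j)]
  have hc0 : 0 < c := by linarith
  calc (numUnitFractionReps (j + 4) 1 1 : ℝ) * x ^ (j + 4)
      ≤ C * (x ^ j * c ^ 2 ^ j) ^ (77 / 25 : ℝ) * x ^ (j + 4) := by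
        gcongr
        refine (hf j).trans ?_
        push_cast [← hx]
        gcongr
        exact hu j
    _ ≤ C * (x ^ (4 * (j + 4)) * (c ^ 2 ^ j) ^ (77 / 25 : ℝ)) * x ^ (j + 4) := by
        rw [Real.mul_rpow (by positivity) (by positivity)]
        gcongr
    _ = C * x ^ (5 * (j + 4)) * c ^ ((77 / 25 : ℝ) * 2 ^ j) := by
        rw [← Real.rpow_natCast c, ← Real.rpow_mul hc0.le]
        push_cast
        rw [mul_comm ((2 : ℝ) ^ j)]
        ring
    _ < c ^ ((1 / 200 : ℝ) * 2 ^ (j + 4)) * c ^ ((77 / 25 : ℝ) * 2 ^ j) := by gcongr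
    _ = c ^ ((79 / 25 : ℝ) * 2 ^ j) := by
        rw [← Real.rpow_add hc0]
        congr 1
        ring
    _ ≤ _ := by
        refine Real.rpow_le_rpow_of_exponent_le hc.le ?_
        rw [show j + 4 - 1 = j + 3 by omega, pow_add]
        have : (0 : ℝ) < 2 ^ j := by positivity
        linarith

theorem mainTheorem5 :
    -- the counted sets are finite
    (∀ k : ℕ, (unitFractionReps k 1 1).Finite ∧ (productSolutions k).Finite) ∧
    -- first bound
    (∀ ε : ℝ, 0 < ε → ∃ C : ℝ, 0 < C ∧ ∀ k : ℕ, 1 ≤ k →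
      (numUnitFractionReps k 1 1 : ℝ) ≤ C * (k : ℝ) ^ ((2 / 15 : ℝ) * 2 ^ (k - 1) + ε)) ∧
    -- the limit defining `c₀` exists, and the second and third bounds hold
    ∃ c₀ : ℝ,
      Filter.Tendsto (fun n : ℕ => (sylvesterU n : ℝ) ^ (1 / (2 : ℝ) ^ n))
        Filter.atTop (nhds c₀) ∧
      (∀ ε : ℝ, 0 < ε → ∃ K : ℕ, ∀ k : ℕ, 1 ≤ k → K ≤ k →
        (numUnitFractionReps k 1 1 : ℝ) < c₀ ^ ((2 / 5 + ε) * (2 : ℝ) ^ (k - 1))) ∧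
      (∀ ε : ℝ, 0 < ε → ∃ K : ℕ, ∀ k : ℕ, 1 ≤ k → K ≤ k →
        ((productSolutions k).ncard : ℝ) ≤ c₀ ^ ((2 / 5 + ε) * (2 : ℝ) ^ k)) := by
  obtain ⟨c, hlim, hc1, hc2, hu⟩ := exists_tendsto_sylvesterU
  obtain ⟨K, hK⟩ := exists_numUnitFractionReps_mul_pow_lt hc1 hu
  have hK' : ∀ k : ℕ, 1 ≤ k → K ≤ k →
      (numUnitFractionReps k 1 1 : ℝ) < c ^ ((2 / 5 : ℝ) * 2 ^ (k - 1)) := by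
    intro k hk1 hk
    refine lt_of_le_of_lt (le_mul_of_one_le_right (by positivity) (one_le_pow₀ ?_)) (hK k hk)
    exact_mod_cast hk1
  refine ⟨fun k => ⟨finite_unitFractionReps_one_one k,
    (finite_productSolutions_and_ncard_le k).1⟩, fun ε hε => ?_, c, hlim, fun ε hε => ?_,
    fun ε hε => ?_⟩
  -- Beyond `K` the bound in `c` holds, and beyond 8 the base `k` exceeds `8`; the finitely many
  -- smaller `k` go into the constant.
  · set M := K + 8
    refine ⟨1 + ∑ k ∈ Finset.range M, (numUnitFractionReps k 1 1 : ℝ), by positivity,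
      fun k hk1 => ?_⟩
    have hkr : (1 : ℝ) ≤ k := by exact_mod_cast hk1
    have hpow : 1 ≤ (k : ℝ) ^ ((2 / 15 : ℝ) * 2 ^ (k - 1) + ε) :=
      Real.one_le_rpow hkr (by positivity)
    have hsum : 0 ≤ ∑ k ∈ Finset.range M, (numUnitFractionReps k 1 1 : ℝ) := by positivity
    rcases Nat.lt_or_ge k M with h | h
    · have h1 : (numUnitFractionReps k 1 1 : ℝ) ≤
          ∑ k ∈ Finset.range M, (numUnitFractionReps k 1 1 : ℝ) :=
        Finset.single_le_sum (f := fun k => (numUnitFractionReps k 1 1 : ℝ))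
          (fun _ _ => by positivity) (Finset.mem_range.mpr h)
      exact (h1.trans (by linarith)).trans (le_mul_of_one_le_right (by positivity) hpow)
    · have hk8 : (8 : ℝ) ≤ k := by exact_mod_cast (by omega : 8 ≤ k)
      calc (numUnitFractionReps k 1 1 : ℝ) ≤ c ^ ((2 / 5 : ℝ) * 2 ^ (k - 1)) :=
            (hK' k hk1 (by omega)).le
        _ ≤ 2 ^ ((2 / 5 : ℝ) * 2 ^ (k - 1)) := by gcongr
        _ = (8 : ℝ) ^ ((2 / 15 : ℝ) * 2 ^ (k - 1)) := by
            rw [show (8 : ℝ) = 2 ^ (3 : ℝ) by norm_num, ← Real.rpow_mul (by norm_num)]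
            congr 1
            ring
        _ ≤ (k : ℝ) ^ ((2 / 15 : ℝ) * 2 ^ (k - 1)) := by gcongr
        _ ≤ (k : ℝ) ^ ((2 / 15 : ℝ) * 2 ^ (k - 1) + ε) :=
            Real.rpow_le_rpow_of_exponent_le hkr (by linarith)
        _ ≤ _ := le_mul_of_one_le_left (by positivity) (by linarith)
  · refine ⟨K, fun k hk1 hk => (hK' k hk1 hk).trans_le ?_⟩
    refine Real.rpow_le_rpow_of_exponent_le hc1.le ?_
    gcongr
    linarith
  -- The representations have `k + 1` terms, which turns `2 ^ (k - 1)` into `2 ^ k`.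
  · refine ⟨K, fun k _ hk => ?_⟩
    calc ((productSolutions k).ncard : ℝ)
        ≤ (numUnitFractionReps (k + 1) 1 1 : ℝ) * ((k + 1).factorial : ℝ) := by
          exact_mod_cast (finite_productSolutions_and_ncard_le k).2
      _ ≤ (numUnitFractionReps (k + 1) 1 1 : ℝ) * ((k + 1 : ℕ) : ℝ) ^ (k + 1) := by
          gcongr
          exact_mod_cast Nat.factorial_le_pow (k + 1)
      _ ≤ c ^ ((2 / 5 : ℝ) * 2 ^ k) := (hK (k + 1) (by omega)).le
      _ ≤ _ := by
          refine Real.rpow_le_rpow_of_exponent_le hc1.le ?_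
          gcongr
          linarith
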